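/- Let $Y$ be a positive random variable with law $F_Y$ whose moment generating function $u\mapsto E[e^{uY}]$ is finite in a neighbourhood of $0$, and let $\lambda>0$, $\theta>0$, $c=(1+\theta)\lambda E[Y]$. For real $n>0$ put $\lambda_n=n\lambda$, $Y_n=Y/\sqrt n$, $c_n=c+(\sqrt n-1)\lambda E[Y]$, and let $\psi_n(x)$ be the probability of ultimate ruin in the scaled Cramér–Lundberg model, that is, $$\psi_n(x)=P(\tau<\infty),\qquad \tau=\inf\{t\ge 0: X_t<0\},\qquad X_t=x+c_nt-\sum_{i=1}^{A_t}Z_i ,$$ where $A$ is a homogeneous Poisson process with intensity $\lambda_n$, and $Z_1,Z_2,\dots$ are i.i.d. with the law of $Y_n$ and independent of $A$. Let $\gamma=2\theta E[Y]/E[Y^2]$. Below, suprema over $d$ are taken over all $d\ge 0$ with $P(Y>d)>0$. Suppose that there is an $m>0$ such that $$\sup_{d}\,E\Big[(Y-d)^2e^{\frac{\gamma}{\sqrt m}(Y-d)}\,\Big|\,Y>d\Big]<\infty ,$$ and fix such an $m$. Let $\varepsilon>0$ and $$\delta=\max\Big[\theta,\ \sup_{d}\big(\gamma E[Y-d\mid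 Y>d]+\varepsilon\big)\Big].$$ Then $\delta<\infty$, and there are real numbers $N>\max(\delta^2,m)$ such that $$\sup_{d}\ \frac{\gamma^2}{\sqrt N}\int_0^1(1-\omega)\,E\Big[(Y-d)^2e^{\frac{\gamma\omega}{\sqrt N}(Y-d)}\,\Big|\,Y>d\Big]\,d\omega\le\varepsilon .$$ For every such $N$, every real $n>N$ and every $x\ge 0$, $$\Big(1-\frac{\delta}{\sqrt n}\Big)e^{-\gamma x}<\psi_n(x).$$ -/

import Mathlib

open MeasureTheory ProbabilityTheory Set
open scoped NNReal ENNReal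

namespace Ruin

/-- `A` is a homogeneous Poisson process with intensity `lam` under `P`: almost surely, `A t`
counts the arrivals up to time `t`, where the inter-arrival times are independent and
exponentially distributed with rate `lam`. -/
structure IsPoissonProcess {Ω : Type*} [MeasurableSpace Ω] (P : Measure Ω) (lam : ℝ)
    (A : ℝ≥0 → Ω → ℕ) : Prop where
  rate_pos : 0 < lam
  measurable : ∀ t, Measurable (A t)
  exists_interarrival : ∃ W : ℕ → Ω → ℝ,
    (∀ i, Measurable (W i)) ∧ (∀ i, P.map (W i) = expMeasure lam) ∧ iIndepFun W P ∧
    ∀ᵐ ω ∂P, ∀ t : ℝ≥0,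
      (A t ω : ℕ∞) = {k : ℕ | ∑ i ∈ Finset.range (k + 1), W i ω ≤ (t : ℝ)}.encard

/-- The random input of a Cramér-Lundberg model: a Poisson process `A` of claim arrivals with
intensity `lam`, and i.i.d. claim sizes `Z 0, Z 1, …` with law `ν`, independent of `A`. -/
structure IsClaimsProcess {Ω : Type*} [MeasurableSpace Ω] (P : Measure Ω) (lam : ℝ)
    (ν : Measure ℝ) (A : ℝ≥0 → Ω → ℕ) (Z : ℕ → Ω → ℝ) : Prop where
  poisson : IsPoissonProcess P lam A
  measurable_claim : ∀ i, Measurable (Z i)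
  law_claim : ∀ i, P.map (Z i) = ν
  indep_claims : iIndepFun Z P
  indep_arrivals_claims : IndepFun (fun ω t => A t ω) (fun ω i => Z i ω) P

/-- The surplus `X_t = x + c t - ∑_{i = 1}^{A_t} Z_i` (the claims being indexed from `0`). -/
def surplus {Ω : Type*} (c : ℝ) (A : ℝ≥0 → Ω → ℕ) (Z : ℕ → Ω → ℝ) (x : ℝ) (t : ℝ≥0) (ω : Ω) :
    ℝ :=
  x + c * t - ∑ i ∈ Finset.range (A t ω), Z i ω

/-- The time of ruin `inf {t ≥ 0 : X_t < 0}`, equal to `∞` if the surplus never is negative. -/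
noncomputable def ruinTime {Ω : Type*} (c : ℝ) (A : ℝ≥0 → Ω → ℕ) (Z : ℕ → Ω → ℝ) (x : ℝ)
    (ω : Ω) : ℝ≥0∞ :=
  sInf {s : ℝ≥0∞ | ∃ t : ℝ≥0, s = t ∧ surplus c A Z x t ω < 0}

/-- The probability of ultimate ruin with initial surplus `x`. -/
noncomputable def ruinProb {Ω : Type*} [MeasurableSpace Ω] (P : Measure Ω) (c : ℝ)
    (A : ℝ≥0 → Ω → ℕ) (Z : ℕ → Ω → ℝ) (x : ℝ) : ℝ :=
  P.real {ω | ruinTime c A Z x ω < ∞}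

/-- The law of `Y / √n` when `Y` has law `ν`. -/
noncomputable def scaledLaw (ν : Measure ℝ) (n : ℝ) : Measure ℝ :=
  ν.map (fun y => y / √n)

/-- The premium rate `c_n = c + (√n - 1) λ E[Y]` of the scaled model. -/
noncomputable def scaledPremium (ν : Measure ℝ) (lam c n : ℝ) : ℝ :=
  c + (√n - 1) * (lam * ∫ y, y ∂ν)

/-- The exponent `γ = 2 θ E[Y] / E[Y²]` of the diffusion approximation. -/
noncomputable def gam (ν : Measure ℝ) (θ : ℝ) : ℝ :=
  2 * θ * (∫ y, y ∂ν) / ∫ y, y ^ 2 ∂ν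

/-- The thresholds `d ≥ 0` for which conditioning on `Y > d` makes sense. -/
def thresholds (ν : Measure ℝ) : Set ℝ := {d | 0 ≤ d ∧ 0 < ν (Ioi d)}

/-- The mean excess `E[Y - d | Y > d]`. -/
noncomputable def meanExcess (ν : Measure ℝ) (d : ℝ) : ℝ :=
  ∫ y, (y - d) ∂(ProbabilityTheory.cond ν (Ioi d))

/-- `E[(Y - d)² exp (a (Y - d)) | Y > d]`, a value in `[0, ∞]`. -/
noncomputable def expExcess (ν : Measure ℝ) (a d : ℝ) : ℝ≥0∞ :=
  ∫⁻ y, ENNReal.ofReal ((y - d) ^ 2 * Real.exp (a * (y - d))) ∂(ProbabilityTheory.cond ν (Ioi d))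

/-- `δ = max (θ, sup_d (γ E[Y - d | Y > d] + ε))`. -/
noncomputable def delta (ν : Measure ℝ) (θ ε : ℝ) : ℝ :=
  max θ (sSup ((fun d => gam ν θ * meanExcess ν d + ε) '' thresholds ν))

/-- `N > max (δ², m)`, and
`sup_d (γ² / √N) ∫₀¹ (1 - w) E[(Y - d)² exp ((γ w / √N) (Y - d)) | Y > d] dw ≤ ε`. -/
def IsAdmissible (ν : Measure ℝ) (θ ε m N : ℝ) : Prop :=
  max (delta ν θ ε ^ 2) m < N ∧
  ⨆ d ∈ thresholds ν, ENNReal.ofReal (gam ν θ ^ 2 / √N) *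
      ∫⁻ w in Icc (0 : ℝ) 1, ENNReal.ofReal (1 - w) * expExcess ν (gam ν θ * w / √N) d
    ≤ ENNReal.ofReal ε

end Ruin

/-!
Put `γ = gam ν θ`, `δ = delta ν θ ε`, `α = 1 - δ / √n`, and let `φ` (`candidate α γ`) be
`α exp (-γ y)` for `y ≥ 0` and `1` for `y < 0`. The bound holds because `φ` is strictly
subharmonic for the surplus on the nonnegative half-line.

Ruin can only happen at a claim, and just after the `k`-th claim the surplus is `x` plus the sum of
the first `k` terms of the i.i.d. sequence `c W_i - Z_i`, where `W_i` are the waiting times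
(`IsClaimsProcess.exists_walk`). The model gives independence of the claims from the counting
process only, so the waiting times are first reconstructed as measurable functionals of that process
(`waitingTime_eq`). Along the walk frozen at ruin the mean of `φ` increases; as the walk
drifts to infinity and `φ` vanishes there, this mean converges to the probability of ruin
(`integral_le_prob_walk_neg`).

Subharmonicity over one claim (`mul_candidate_le_integral_step`) needs two facts. First,
`α E[exp (γ (Z - y)); Z > y] ≤ P(Z > y)`, so that extending `α exp (-γ y)` to the negative
half-line in place of `1` can only lower the mean of `φ(y - Z)`. As `(1 - t) (1 + t) ≤ 1`, it is
enough that `E[exp (γ (Y - d) / √n) | Y > d] ≤ 1 + δ / √n`, which is Taylor's formula with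
integral remainder (`lintegral_exp_excess_le`) and the definition of `δ` and of admissibility.
Second, `E[exp (γ Z)] λ_n / (λ_n + γ c_n) > 1`; here `γ` is such that the second-order expansion of
`λ_n (E[exp (γ Z)] - 1)` is exactly `γ c_n`, and the cubic term is positive (`lt_integral_exp`).
-/

namespace Ruin

open Filter Topology

/-! ### Walks stopped at their first negative value -/

/-- The walk with start `x` and increments `s 0, s 1, …`, frozen as soon as it is negative. -/
noncomputable def stoppedWalk (x : ℝ) (s : ℕ → ℝ) : ℕ → ℝ
  | 0 => x
  | k + 1 => if stoppedWalk x s k < 0 then stoppedWalk x s k else stoppedWalk x s k + s k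

lemma measurable_stoppedWalk (x : ℝ) (k : ℕ) : Measurable fun s => stoppedWalk x s k := by
  induction k with
  | zero => exact measurable_const
  | succ k ih =>
    exact Measurable.ite (measurableSet_lt ih measurable_const) ih (ih.add (measurable_pi_apply k))

lemma stoppedWalk_congr (x : ℝ) {s t : ℕ → ℝ} {k : ℕ} (h : ∀ i < k, s i = t i) :
    stoppedWalk x s k = stoppedWalk x t k := by
  induction k with
  | zero => rfl
  | succ k ih =>
    simp only [stoppedWalk, ih fun i hi => h i (hi.trans k.lt_succ_self), h k k.lt_succ_self]

lemma stoppedWalk_eq_of_neg {x : ℝ} {s : ℕ → ℝ} {k : ℕ} (h : stoppedWalk x s k < 0) {l : ℕ}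
    (hl : k ≤ l) : stoppedWalk x s l = stoppedWalk x s k := by
  induction l, hl using Nat.le_induction with
  | base => rfl
  | succ l _ ih => rw [stoppedWalk, if_pos (ih ▸ h), ih]

lemma stoppedWalk_eq_sum {x : ℝ} {s : ℕ → ℝ} {k : ℕ} (h : ∀ j < k, 0 ≤ stoppedWalk x s j) :
    stoppedWalk x s k = x + ∑ i ∈ Finset.range k, s i := by
  induction k with
  | zero => simp [stoppedWalk]
  | succ k ih =>
    rw [stoppedWalk, if_neg (h k k.lt_succ_self).not_gt,
      ih fun j hj => h j (hj.trans k.lt_succ_self), Finset.sum_range_succ, add_assoc]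

lemma exists_sum_neg_of_stoppedWalk_neg {x : ℝ} {s : ℕ → ℝ} (h : ∃ k, stoppedWalk x s k < 0) :
    ∃ k, x + ∑ i ∈ Finset.range k, s i < 0 := by
  classical
  refine ⟨Nat.find h, ?_⟩
  rw [← stoppedWalk_eq_sum fun j hj => not_lt.1 (Nat.find_min h hj)]
  exact Nat.find_spec h

variable {Ω : Type*} [MeasurableSpace Ω] {P : Measure Ω}

/-- The stopped walk at time `k` is a function of the first `k` increments. -/
lemma indepFun_stoppedWalk {ξ : ℕ → Ω → ℝ} (hm : ∀ i, Measurable (ξ i)) (hi : iIndepFun ξ P)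
    (x : ℝ) (k : ℕ) : IndepFun (fun ω => stoppedWalk x (fun i => ξ i ω) k) (ξ k) P := by
  have h := hi.indepFun_finset (Finset.range k) {k} (by simp) hm
  let f : (Finset.range k → ℝ) → ℝ := fun t =>
    stoppedWalk x (fun i => if hk : i ∈ Finset.range k then t ⟨i, hk⟩ else 0) k
  have hf : Measurable f := by
    refine (measurable_stoppedWalk x k).comp (measurable_pi_lambda _ fun i => ?_)
    by_cases hk : i ∈ Finset.range k
    · simpa only [hk, dif_pos] using measurable_pi_apply _
    · simp only [hk, dif_neg, not_false_eq_true]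
      exact measurable_const
  have h2 := h.comp hf (measurable_pi_apply (⟨k, by simp⟩ : ({k} : Finset ℕ)))
  have h3 : (fun ω => stoppedWalk x (fun i => ξ i ω) k) =
      f ∘ fun ω (i : Finset.range k) => ξ i ω := by
    funext ω
    refine stoppedWalk_congr x fun i hi => ?_
    simp [hi]
  rw [h3]
  exact h2

/-- By the strong law of large numbers, a walk with positive mean increment drifts to infinity. -/
lemma tendsto_walk_atTop [IsProbabilityMeasure P] {ξ : ℕ → Ω → ℝ} {η : Measure ℝ}
    (hm : ∀ i, Measurable (ξ i)) (hi : iIndepFun ξ P) (hlaw : ∀ i, P.map (ξ i) = η)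
    (hint : Integrable (fun y => y) η) (hmean : 0 < ∫ y, y ∂η) (x : ℝ) :
    ∀ᵐ ω ∂P, Tendsto (fun k => x + ∑ i ∈ Finset.range k, ξ i ω) atTop atTop := by
  have h0 : Integrable (ξ 0) P := by
    rw [← hlaw 0] at hint
    exact hint.comp_measurable (hm 0)
  have hE : P[ξ 0] = ∫ y, y ∂η := by
    rw [← hlaw 0, integral_map (hm 0).aemeasurable (by fun_prop)]
  filter_upwards [strong_law_ae_real ξ h0 (fun i j hij => hi.indepFun hij)
    fun i => ⟨(hm i).aemeasurable, (hm 0).aemeasurable, by rw [hlaw, hlaw]⟩] with ω hω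
  rw [hE] at hω
  refine tendsto_atTop_add_const_left _ x ?_
  refine (hω.pos_mul_atTop hmean tendsto_natCast_atTop_atTop).congr' ?_
  filter_upwards [eventually_gt_atTop 0] with k hk
  have : (k : ℝ) ≠ 0 := by positivity
  field_simp

/-- The expectation of `φ` along the stopped walk is nondecreasing if `φ` is subharmonic on the
nonnegative half-line. -/
lemma integral_stoppedWalk_le_succ [IsProbabilityMeasure P] {ξ : ℕ → Ω → ℝ} {η : Measure ℝ}
    (hm : ∀ i, Measurable (ξ i)) (hi : iIndepFun ξ P) (hlaw : ∀ i, P.map (ξ i) = η)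
    {φ : ℝ → ℝ} (hφm : Measurable φ) (hφ0 : ∀ y, 0 ≤ φ y) (hφ1 : ∀ y, φ y ≤ 1)
    (hsub : ∀ y, 0 ≤ y → φ y ≤ ∫ e, φ (y + e) ∂η) (x : ℝ) (k : ℕ) :
    ∫ ω, φ (stoppedWalk x (fun i => ξ i ω) k) ∂P ≤
      ∫ ω, φ (stoppedWalk x (fun i => ξ i ω) (k + 1)) ∂P := by
  set R : Ω → ℝ := fun ω => stoppedWalk x (fun i => ξ i ω) k with hR
  have hRm : Measurable R := (measurable_stoppedWalk x k).comp (measurable_pi_lambda _ hm)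
  have hη : IsProbabilityMeasure η := hlaw 0 ▸ Measure.isProbabilityMeasure_map (hm 0).aemeasurable
  have hκ : IsProbabilityMeasure (P.map R) := Measure.isProbabilityMeasure_map hRm.aemeasurable
  have hbd : ∀ y, ‖φ y‖ ≤ 1 := fun y => by
    rw [Real.norm_of_nonneg (hφ0 y)]; exact hφ1 y
  let g : ℝ × ℝ → ℝ := fun p => if p.1 < 0 then φ p.1 else φ (p.1 + p.2)
  have hgm : Measurable g := by
    refine Measurable.ite (measurableSet_lt measurable_fst measurable_const) ?_ ?_ <;> fun_prop
  have hgbd : ∀ p, ‖g p‖ ≤ 1 := fun p => by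
    by_cases h : p.1 < 0 <;> simp [g, h, -Real.norm_eq_abs, hbd]
  have hgint : Integrable g ((P.map R).prod η) :=
    Integrable.of_bound hgm.aestronglyMeasurable 1 (ae_of_all _ hgbd)
  have hprod : P.map (fun ω => (R ω, ξ k ω)) = (P.map R).prod η := by
    rw [(indepFun_iff_map_prod_eq_prod_map_map hRm.aemeasurable (hm k).aemeasurable).1
      (indepFun_stoppedWalk hm hi x k), hlaw]
  have h1 : ∫ ω, φ (stoppedWalk x (fun i => ξ i ω) (k + 1)) ∂P =
      ∫ r, ∫ e, g (r, e) ∂η ∂(P.map R) := by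
    rw [← integral_prod _ hgint, ← hprod,
      integral_map (hRm.prodMk (hm k)).aemeasurable hgm.aestronglyMeasurable]
    refine integral_congr_ae (ae_of_all _ fun ω => ?_)
    simp only [stoppedWalk, g, hR]
    split_ifs <;> rfl
  have h2 : ∫ ω, φ (R ω) ∂P = ∫ r, φ r ∂(P.map R) := by
    rw [integral_map hRm.aemeasurable hφm.aestronglyMeasurable]
  rw [h1]
  refine h2.le.trans (integral_mono ?_ hgint.integral_prod_left fun r => ?_)
  · exact Integrable.of_bound hφm.aestronglyMeasurable 1 (ae_of_all _ hbd)
  · by_cases h : r < 0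
    · simp [g, h]
    · simpa [g, h] using hsub r (not_lt.1 h)

/-- A function that is subharmonic for the walk on the nonnegative half-line, equal to one on the
negative half-line and vanishing at infinity bounds the probability of becoming negative from
below, since the walk drifts to infinity. The bound is by its mean after one step. -/
theorem integral_le_prob_walk_neg [IsProbabilityMeasure P] {ξ : ℕ → Ω → ℝ} {η : Measure ℝ}
    (hm : ∀ i, Measurable (ξ i)) (hi : iIndepFun ξ P) (hlaw : ∀ i, P.map (ξ i) = η)
    (hint : Integrable (fun y => y) η) (hmean : 0 < ∫ y, y ∂η)
    {φ : ℝ → ℝ} (hφm : Measurable φ) (hφ0 : ∀ y, 0 ≤ φ y) (hφ1 : ∀ y, φ y ≤ 1)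
    (hφneg : ∀ y < 0, φ y = 1) (hφlim : Tendsto φ atTop (𝓝 0))
    (hsub : ∀ y, 0 ≤ y → φ y ≤ ∫ e, φ (y + e) ∂η) {x : ℝ} (hx : 0 ≤ x) :
    ∫ e, φ (x + e) ∂η ≤ P.real {ω | ∃ k, x + ∑ i ∈ Finset.range k, ξ i ω < 0} := by
  set R : ℕ → Ω → ℝ := fun k ω => stoppedWalk x (fun i => ξ i ω) k with hR
  have hRm : ∀ k, Measurable (R k) := fun k =>
    (measurable_stoppedWalk x k).comp (measurable_pi_lambda _ hm)
  have hmono : Monotone fun k => ∫ ω, φ (R k ω) ∂P :=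
    monotone_nat_of_le_succ (integral_stoppedWalk_le_succ hm hi hlaw hφm hφ0 hφ1 hsub x)
  have hone : ∫ ω, φ (R 1 ω) ∂P = ∫ e, φ (x + e) ∂η := by
    have hshift : Measurable fun e => φ (x + e) := hφm.comp (measurable_const_add x)
    rw [← hlaw 0, integral_map (hm 0).aemeasurable hshift.aestronglyMeasurable]
    simp [hR, stoppedWalk, hx.not_gt]
  set D : Set Ω := {ω | ∃ k, R k ω < 0} with hD
  have hDm : MeasurableSet D := by
    rw [hD, ofPred_exists]
    exact MeasurableSet.iUnion fun k => measurableSet_lt (hRm k) measurable_const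
  have hlim : Tendsto (fun k => ∫ ω, φ (R k ω) ∂P) atTop
      (𝓝 (∫ ω, D.indicator (fun _ => 1) ω ∂P)) := by
    refine tendsto_integral_of_dominated_convergence (fun _ => 1)
      (fun k => (hφm.comp (hRm k)).aestronglyMeasurable) (integrable_const _)
      (fun k => ae_of_all _ fun ω => ?_) ?_
    · rw [Real.norm_of_nonneg (hφ0 _)]; exact hφ1 _
    · filter_upwards [tendsto_walk_atTop hm hi hlaw hint hmean x] with ω hω
      by_cases h : ω ∈ D
      · rw [indicator_of_mem h]
        obtain ⟨k, hk⟩ := h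
        refine tendsto_const_nhds.congr' ?_
        filter_upwards [eventually_ge_atTop k] with l hl
        have : R l ω = R k ω := stoppedWalk_eq_of_neg hk hl
        rw [this, hφneg _ hk]
      · rw [indicator_of_notMem h]
        have h' : ∀ k, 0 ≤ stoppedWalk x (fun i => ξ i ω) k := fun k =>
          not_lt.1 fun hk => h ⟨k, hk⟩
        refine (hφlim.comp hω).congr fun k => ?_
        simp only [Function.comp, hR, stoppedWalk_eq_sum fun j (_ : j < k) => h' j]
  rw [integral_indicator_const _ hDm, smul_eq_mul, mul_one] at hlim
  rw [← hone]
  refine (hmono.ge_of_tendsto hlim 1).trans (measureReal_mono fun ω hω => ?_)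
  exact exists_sum_neg_of_stoppedWalk_neg hω

/-! ### Waiting times as functionals of the counting process -/

/-- The time at which the counting path `a` first exceeds `k`, computed along the rational times
so as to be a measurable function of the path. -/
noncomputable def arrivalTime (k : ℕ) (a : ℝ≥0 → ℕ) : ℝ≥0∞ :=
  ⨅ q : ℚ≥0, if k < a q then ((q : ℝ≥0) : ℝ≥0∞) else ∞

lemma measurable_arrivalTime (k : ℕ) : Measurable (arrivalTime k) := by
  refine Measurable.iInf fun q => Measurable.ite ?_ measurable_const measurable_const
  exact measurableSet_lt measurable_const (measurable_pi_apply _)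

/-- The `k`-th waiting time of the counting path `a`. -/
noncomputable def waitingTime (k : ℕ) (a : ℝ≥0 → ℕ) : ℝ :=
  (arrivalTime k a).toReal - if k = 0 then 0 else (arrivalTime (k - 1) a).toReal

lemma measurable_waitingTime (k : ℕ) : Measurable (waitingTime k) := by
  unfold waitingTime
  split_ifs
  · exact (measurable_arrivalTime k).ennreal_toReal.sub measurable_const
  · exact (measurable_arrivalTime k).ennreal_toReal.sub
      (measurable_arrivalTime (k - 1)).ennreal_toReal

lemma lt_count_iff {w : ℕ → ℝ} (hw : ∀ i, 0 < w i) {n : ℕ} {t : ℝ}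
    (hn : (n : ℕ∞) = {k : ℕ | ∑ i ∈ Finset.range (k + 1), w i ≤ t}.encard) (k : ℕ) :
    k < n ↔ ∑ i ∈ Finset.range (k + 1), w i ≤ t := by
  have hmono : Monotone fun k => ∑ i ∈ Finset.range (k + 1), w i :=
    monotone_nat_of_le_succ fun k => by
      rw [Finset.sum_range_succ _ (k + 1)]; linarith [hw (k + 1)]
  constructor
  · intro hk
    by_contra h
    have hsub : {k : ℕ | ∑ i ∈ Finset.range (k + 1), w i ≤ t} ⊆ (Finset.range k : Set ℕ) := by
      intro j hj
      rw [Finset.coe_range, mem_Iio]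
      by_contra hjk
      exact h ((hmono (not_lt.1 hjk)).trans hj)
    have := encard_le_encard hsub
    rw [← hn, encard_coe_eq_coe_finsetCard, Finset.card_range, Nat.cast_le] at this
    omega
  · intro hk
    have hsub : (Finset.range (k + 1) : Set ℕ) ⊆ {k : ℕ | ∑ i ∈ Finset.range (k + 1), w i ≤ t} := by
      intro j hj
      rw [Finset.coe_range, mem_Iio] at hj
      exact (hmono (Nat.le_of_lt_succ hj)).trans hk
    have := encard_le_encard hsub
    rw [← hn, encard_coe_eq_coe_finsetCard, Finset.card_range, Nat.cast_le] at this
    omega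

lemma arrivalTime_eq {w : ℕ → ℝ} (hw : ∀ i, 0 < w i) {a : ℝ≥0 → ℕ}
    (ha : ∀ t : ℝ≥0, (a t : ℕ∞) = {k : ℕ | ∑ i ∈ Finset.range (k + 1), w i ≤ (t : ℝ)}.encard)
    (k : ℕ) : (arrivalTime k a).toReal = ∑ i ∈ Finset.range (k + 1), w i := by
  set T := ∑ i ∈ Finset.range (k + 1), w i with hT
  have hT0 : 0 ≤ T := Finset.sum_nonneg fun i _ => (hw i).le
  suffices h : arrivalTime k a = ENNReal.ofReal T by rw [h, ENNReal.toReal_ofReal hT0]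
  refine le_antisymm (le_of_forall_gt fun b hb => ?_) (le_iInf fun q => ?_)
  · obtain ⟨r, hr, hrb⟩ := ENNReal.lt_iff_exists_nnreal_btwn.1 hb
    have hr' : T.toNNReal < r := ENNReal.coe_lt_coe.1 hr
    obtain ⟨q, hq, hqr⟩ := exists_rat_btwn (NNReal.coe_lt_coe.2 hr')
    have hq0 : 0 ≤ q := by
      have : (0 : ℝ) < q := T.toNNReal.coe_nonneg.trans_lt hq
      exact_mod_cast this.le
    lift q to ℚ≥0 using hq0
    have hTq : T ≤ ((q : ℝ≥0) : ℝ) := by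
      have := hq.le
      rw [Real.coe_toNNReal _ hT0] at this
      exact this
    refine (iInf_le _ q).trans_lt ?_
    rw [if_pos ((lt_count_iff hw (ha q) k).2 hTq)]
    refine lt_trans ?_ hrb
    have : ((q : ℝ≥0) : ℝ) < r := hqr
    exact_mod_cast this
  · split_ifs with h
    · exact ENNReal.ofReal_le_of_le_toReal (by simpa using (lt_count_iff hw (ha q) k).1 h)
    · exact le_top

lemma waitingTime_eq {w : ℕ → ℝ} (hw : ∀ i, 0 < w i) {a : ℝ≥0 → ℕ}
    (ha : ∀ t : ℝ≥0, (a t : ℕ∞) = {k : ℕ | ∑ i ∈ Finset.range (k + 1), w i ≤ (t : ℝ)}.encard)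
    (k : ℕ) : waitingTime k a = w k := by
  rw [waitingTime, arrivalTime_eq hw ha]
  rcases k with _ | k
  · simp
  · rw [if_neg k.succ_ne_zero, Nat.add_sub_cancel, arrivalTime_eq hw ha, Finset.sum_range_succ]
    ring

/-! ### Independence of sequences -/

/-- Two independent sequences, each of them independent, form one independent family. -/
lemma iIndepFun_sumElim [IsProbabilityMeasure P] {ι κ β : Type*} [MeasurableSpace β]
    {W : ι → Ω → β} {Z : κ → Ω → β}
    (hW : iIndepFun W P) (hZ : iIndepFun Z P)
    (h : IndepFun (fun ω i => W i ω) (fun ω i => Z i ω) P) :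
    iIndepFun (Sum.elim W Z) P := by
  classical
  rw [iIndepFun_iff_measure_inter_preimage_eq_mul] at hW hZ ⊢
  intro S sets hsets
  have h1 := hW S.toLeft (sets := fun i => sets (Sum.inl i)) fun i hi =>
    hsets _ (Finset.mem_toLeft.1 hi)
  have h2 := hZ S.toRight (sets := fun i => sets (Sum.inr i)) fun i hi =>
    hsets _ (Finset.mem_toRight.1 hi)
  have h3 := h.measure_inter_preimage_eq_mul
    (⋂ i ∈ S.toLeft, (fun w : ι → β => w i) ⁻¹' sets (Sum.inl i))
    (⋂ i ∈ S.toRight, (fun w : κ → β => w i) ⁻¹' sets (Sum.inr i))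
    (Finset.measurableSet_biInter _ fun i hi =>
      measurable_pi_apply i (hsets _ (Finset.mem_toLeft.1 hi)))
    (Finset.measurableSet_biInter _ fun i hi =>
      measurable_pi_apply i (hsets _ (Finset.mem_toRight.1 hi)))
  simp only [preimage_iInter, ← preimage_comp] at h3
  have h4 : ⋂ i ∈ S, Sum.elim W Z i ⁻¹' sets i =
      (⋂ i ∈ S.toLeft, W i ⁻¹' sets (Sum.inl i)) ∩ ⋂ i ∈ S.toRight, Z i ⁻¹' sets (Sum.inr i) := by
    ext ω
    simp [Sum.forall]
  rw [h4, ← Finset.toLeft_disjSum_toRight (u := S), Finset.prod_disjSum,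
    Finset.toLeft_disjSum_toRight (u := S)]
  simp only [Sum.elim_inl, Sum.elim_inr]
  rw [← h1, ← h2]
  exact h3

/-- Grouping an independent family indexed by pairs along the first index gives an independent
family of families. -/
lemma iIndepFun_curry [IsProbabilityMeasure P] {ι κ β : Type*} [MeasurableSpace β]
    {X : ι → κ → Ω → β} (mX : ∀ i j, Measurable (X i j))
    (h : iIndepFun (fun p : ι × κ => X p.1 p.2) P) : iIndepFun (fun i ω j => X i j ω) P := by
  have hprob : ∀ i j, IsProbabilityMeasure (P.map (X i j)) := fun i j =>
    Measure.isProbabilityMeasure_map (mX i j).aemeasurable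
  rw [iIndepFun_iff_map_fun_eq_infinitePi_map fun i => by fun_prop]
  have h1 : ∀ i, P.map (fun ω j => X i j ω) = Measure.infinitePi fun j => P.map (X i j) := fun i =>
    (h.precomp (g := fun j => (i, j)) fun j k hjk => (Prod.mk.inj hjk).2).map_fun_eq_infinitePi_map
      (mX i)
  simp_rw [h1]
  rw [← Measure.infinitePi_map_curry fun i j => P.map (X i j),
    ← h.map_fun_eq_infinitePi_map (X := fun p : ι × κ => X p.1 p.2) fun p => mX p.1 p.2,
    Measure.map_map (by fun_prop) (by fun_prop)]
  rfl

/-! ### The exponential distribution -/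

lemma ae_pos_expMeasure {lam : ℝ} (hlam : 0 < lam) : ∀ᵐ w ∂(expMeasure lam), 0 < w := by
  have := isProbabilityMeasure_expMeasure hlam
  have h := cdf_expMeasure_eq hlam 0
  rw [cdf_eq_real, if_pos le_rfl, mul_zero, neg_zero, Real.exp_zero, sub_self,
    measureReal_eq_zero_iff] at h
  rw [ae_iff]
  simpa [Iic, not_lt] using h

lemma integral_expMeasure {lam : ℝ} (hlam : 0 < lam) (f : ℝ → ℝ) :
    ∫ w, f w ∂(expMeasure lam) = ∫ w in Ioi 0, lam * Real.exp (-(lam * w)) * f w := by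
  have hd : expMeasure lam = volume.withDensity (exponentialPDF lam) := rfl
  have hm : Measurable (exponentialPDF lam) := (measurable_exponentialPDFReal lam).ennreal_ofReal
  rw [hd, integral_withDensity_eq_integral_toReal_smul hm (by simp [exponentialPDF]),
    ← integral_Ici_eq_integral_Ioi, ← integral_indicator measurableSet_Ici]
  refine integral_congr_ae (ae_of_all _ fun w => ?_)
  by_cases hw : 0 ≤ w
  · simp only [smul_eq_mul]
    rw [indicator_of_mem (mem_Ici.2 hw), exponentialPDF_of_nonneg hw,
      ENNReal.toReal_ofReal (by positivity)]
  · simp only [smul_eq_mul]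
    rw [indicator_of_notMem (by simpa using hw), exponentialPDF_of_neg (not_le.1 hw)]
    simp

lemma integral_exp_neg_expMeasure {lam s : ℝ} (hlam : 0 < lam) (hs : 0 < s) :
    ∫ w, Real.exp (-(s * w)) ∂(expMeasure lam) = lam / (lam + s) := by
  rw [integral_expMeasure hlam]
  have h : ∀ w : ℝ, lam * Real.exp (-(lam * w)) * Real.exp (-(s * w)) =
      lam * Real.exp (-(lam + s) * w) := fun w => by
    rw [mul_assoc, ← Real.exp_add]; ring_nf
  simp_rw [h]
  rw [integral_const_mul, integral_exp_mul_Ioi (by linarith), mul_zero, Real.exp_zero,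
    neg_div_neg_eq, mul_one_div]

lemma integral_id_expMeasure {lam : ℝ} (hlam : 0 < lam) :
    ∫ w, w ∂(expMeasure lam) = 1 / lam := by
  rw [integral_expMeasure hlam]
  have h := Real.integral_rpow_mul_exp_neg_mul_Ioi (a := 2) two_pos hlam
  have h2 : ∀ w : ℝ, lam * Real.exp (-(lam * w)) * w =
      lam * (w ^ ((2 : ℝ) - 1) * Real.exp (-(lam * w))) := fun w => by
    norm_num; ring
  simp_rw [h2]
  rw [integral_const_mul, h]
  norm_num
  field_simp

/-! ### The surplus just after the claims -/

/-- The net changes `c W_i - Z_i` of the surplus between claims are i.i.d.; moreover a negative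
value of the walk they generate is a value of the surplus just after a claim. -/
theorem IsClaimsProcess.exists_walk [IsProbabilityMeasure P] {lam : ℝ} {ν : Measure ℝ}
    {A : ℝ≥0 → Ω → ℕ} {Z : ℕ → Ω → ℝ} (h : IsClaimsProcess P lam ν A Z) (c : ℝ) :
    ∃ ξ : ℕ → Ω → ℝ, (∀ i, Measurable (ξ i)) ∧ iIndepFun ξ P ∧
      (∀ i, P.map (ξ i) = ((expMeasure lam).prod ν).map fun p => c * p.1 - p.2) ∧
      ∀ x, P.real {ω | ∃ k, x + ∑ i ∈ Finset.range k, ξ i ω < 0} ≤ ruinProb P c A Z x := by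
  obtain ⟨hlam, hAm, W, hWm, hWlaw, hWi, hWA⟩ := h.poisson
  have hpos : ∀ᵐ ω ∂P, ∀ i, 0 < W i ω := ae_all_iff.2 fun i => by
    have := ae_pos_expMeasure hlam
    rw [← hWlaw i] at this
    exact ae_of_ae_map (hWm i).aemeasurable this
  -- The waiting times are functionals of the counting process, hence independent of the claims.
  have hWZ : IndepFun (fun ω i => W i ω) (fun ω i => Z i ω) P := by
    have h1 := h.indep_arrivals_claims.comp
      (measurable_pi_lambda _ measurable_waitingTime : Measurable fun a k => waitingTime k a)
      measurable_id
    refine h1.congr ?_ (ae_eq_refl _)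
    filter_upwards [hpos, hWA] with ω hω hA
    funext k
    exact waitingTime_eq hω hA k
  have hall : iIndepFun (Sum.elim W Z) P := iIndepFun_sumElim hWi h.indep_claims hWZ
  let X : ℕ → Bool → Ω → ℝ := fun i b => Sum.elim W Z (if b then Sum.inl i else Sum.inr i)
  have hX : ∀ i b, Measurable (X i b) := by
    rintro i (_ | _)
    · exact h.measurable_claim i
    · exact hWm i
  have hXi : iIndepFun (fun p : ℕ × Bool => X p.1 p.2) P := by
    refine hall.precomp (g := fun p : ℕ × Bool => if p.2 then Sum.inl p.1 else Sum.inr p.1) ?_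
    rintro ⟨i, _ | _⟩ ⟨j, _ | _⟩ hij <;> simp_all
  have hgm : Measurable fun v : Bool → ℝ => c * v true - v false := by fun_prop
  refine ⟨fun i ω => c * W i ω - Z i ω, fun i => ((hWm i).const_mul c).sub (h.measurable_claim i),
    (iIndepFun_curry hX hXi).comp (fun _ v => c * v true - v false) fun _ => hgm, fun i => ?_,
    fun x => ?_⟩
  · have hi : IndepFun (W i) (Z i) P := hWZ.comp (measurable_pi_apply i) (measurable_pi_apply i)
    rw [← hWlaw i, ← h.law_claim i, ← (indepFun_iff_map_prod_eq_prod_map_map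
      (hWm i).aemeasurable (h.measurable_claim i).aemeasurable).1 hi,
      Measure.map_map (by fun_prop) ((hWm i).prodMk (h.measurable_claim i))]
    rfl
  · refine ENNReal.toReal_mono (measure_ne_top _ _) (measure_mono_ae ?_)
    filter_upwards [hpos, hWA] with ω hω hA hneg
    obtain ⟨k, hk⟩ := hneg
    have hT0 : 0 ≤ ∑ i ∈ Finset.range k, W i ω := Finset.sum_nonneg fun i _ => (hω i).le
    -- Exactly `k` claims have arrived at the time of the `k`-th claim.
    have hcount : A ⟨_, hT0⟩ ω = k := by
      refine eq_of_forall_lt_iff fun j => ?_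
      rw [lt_count_iff hω (hA ⟨_, hT0⟩) j]
      constructor
      · intro hj
        by_contra hjk
        have h2 : Finset.range k ⊆ Finset.range (j + 1) := Finset.range_subset_range.2 (by omega)
        have h3 : ∑ i ∈ Finset.range k, W i ω < ∑ i ∈ Finset.range (j + 1), W i ω :=
          Finset.sum_lt_sum_of_subset h2 (i := j) (by simp) (by simpa using hjk) (hω j)
            fun i _ _ => (hω i).le
        exact hj.not_gt h3
      · intro hj
        exact Finset.sum_le_sum_of_subset_of_nonneg (Finset.range_subset_range.2 hj)
          fun i _ _ => (hω i).le
    have hlt : surplus c A Z x ⟨_, hT0⟩ ω < 0 := by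
      unfold surplus
      rw [hcount]
      convert hk using 1
      rw [Finset.sum_sub_distrib, ← Finset.mul_sum]
      exact (add_sub_assoc _ _ _)
    change ruinTime c A Z x ω < ∞
    refine lt_of_le_of_lt (sInf_le ?_) (ENNReal.coe_lt_top (r := ⟨_, hT0⟩))
    exact ⟨_, rfl, hlt⟩

/-! ### The subharmonic function -/

/-- The function equal to `α exp (-γ y)` for `y ≥ 0` and to the ruin probability `1` for
`y < 0`. -/
noncomputable def candidate (α γ y : ℝ) : ℝ := if y < 0 then 1 else α * Real.exp (-(γ * y))

lemma measurable_candidate (α γ : ℝ) : Measurable (candidate α γ) :=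
  Measurable.ite (measurableSet_lt measurable_id measurable_const) measurable_const (by fun_prop)

lemma candidate_nonneg {α : ℝ} (hα : 0 ≤ α) (γ y : ℝ) : 0 ≤ candidate α γ y := by
  unfold candidate
  split_ifs
  · exact zero_le_one
  · exact mul_nonneg hα (Real.exp_pos _).le

lemma candidate_le_one {α γ : ℝ} (hα1 : α ≤ 1) (hγ : 0 ≤ γ) (y : ℝ) :
    candidate α γ y ≤ 1 := by
  unfold candidate
  split_ifs with h
  · exact le_rfl
  · exact mul_le_one₀ hα1 (Real.exp_pos _).le
      (Real.exp_le_one_iff.2 (neg_nonpos.2 (mul_nonneg hγ (not_lt.1 h))))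

lemma tendsto_candidate (α : ℝ) {γ : ℝ} (hγ : 0 < γ) : Tendsto (candidate α γ) atTop (𝓝 0) := by
  have h : Tendsto (fun y => α * Real.exp (-(γ * y))) atTop (𝓝 (α * 0)) :=
    (Real.tendsto_exp_neg_atTop_nhds_zero.comp (tendsto_id.const_mul_atTop hγ)).const_mul α
  rw [mul_zero] at h
  refine h.congr' ?_
  filter_upwards [eventually_ge_atTop 0] with y hy
  rw [candidate, if_neg hy.not_gt]

/-- The tail condition says that, at the moment of ruin, replacing `1` by the continuation of the
exponential below zero does not increase the mean. -/
lemma mul_mgf_le_integral_candidate {ρ : Measure ℝ} [IsProbabilityMeasure ρ] {α γ : ℝ}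
    (hα : 0 ≤ α) (hα1 : α ≤ 1) (hγ : 0 ≤ γ)
    (hexp : Integrable (fun z => Real.exp (γ * z)) ρ) {y : ℝ}
    (htail : α * ∫ z in Ioi y, Real.exp (γ * (z - y)) ∂ρ ≤ ρ.real (Ioi y)) :
    α * Real.exp (-(γ * y)) * ∫ z, Real.exp (γ * z) ∂ρ ≤ ∫ z, candidate α γ (y - z) ∂ρ := by
  have hsplit : ∀ z, Real.exp (γ * (z - y)) = Real.exp (-(γ * y)) * Real.exp (γ * z) := fun z => by
    rw [← Real.exp_add]; ring_nf
  have hexp' : Integrable (fun z => Real.exp (γ * (z - y))) ρ := by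
    simp_rw [hsplit]; exact hexp.const_mul _
  have hφ : Integrable (fun z => candidate α γ (y - z)) ρ :=
    Integrable.of_bound ((measurable_candidate α γ).comp
      (measurable_const.sub measurable_id)).aestronglyMeasurable 1 (ae_of_all _ fun z => by
        rw [Real.norm_of_nonneg (candidate_nonneg hα γ _)]
        exact candidate_le_one hα1 hγ _)
  rw [mul_assoc, ← integral_const_mul]
  simp_rw [← hsplit]
  rw [← integral_add_compl (measurableSet_Ioi (a := y)) hexp',
    ← integral_add_compl (measurableSet_Ioi (a := y)) hφ, mul_add]
  refine add_le_add (htail.trans (le_of_eq ?_)) (le_of_eq ?_)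
  · rw [setIntegral_congr_fun (g := fun _ => (1 : ℝ)) measurableSet_Ioi fun z hz => ?_]
    · simp
    · simp only [candidate]
      rw [if_pos (by linarith [mem_Ioi.1 hz])]
  · rw [← integral_const_mul]
    refine setIntegral_congr_fun measurableSet_Ioi.compl fun z hz => ?_
    have hz' : z ≤ y := by simpa using hz
    simp only [candidate]
    rw [if_neg (by linarith)]
    ring_nf

/-- Over one claim the mean of the candidate grows at least by the factor
`E[exp (γ Z)] λ / (λ + γ c)`. -/
lemma mul_candidate_le_integral_step {ρ : Measure ℝ} [IsProbabilityMeasure ρ] {α γ lam c : ℝ}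
    (hα : 0 ≤ α) (hα1 : α ≤ 1) (hγ : 0 < γ) (hlam : 0 < lam) (hc : 0 < c)
    (hexp : Integrable (fun z => Real.exp (γ * z)) ρ)
    (htail : ∀ y, 0 ≤ y → α * ∫ z in Ioi y, Real.exp (γ * (z - y)) ∂ρ ≤ ρ.real (Ioi y))
    {x : ℝ} (hx : 0 ≤ x) :
    ((∫ z, Real.exp (γ * z) ∂ρ) * (lam / (lam + γ * c))) * candidate α γ x ≤
      ∫ e, candidate α γ (x + e) ∂(((expMeasure lam).prod ρ).map fun p => c * p.1 - p.2) := by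
  have := isProbabilityMeasure_expMeasure hlam
  have hm := measurable_candidate α γ
  have hm1 : Measurable fun e => candidate α γ (x + e) := hm.comp (measurable_const_add x)
  have hm2 : Measurable fun p : ℝ × ℝ => candidate α γ (x + (c * p.1 - p.2)) :=
    hm1.comp (by fun_prop)
  have hint : Integrable (fun p : ℝ × ℝ => candidate α γ (x + (c * p.1 - p.2)))
      ((expMeasure lam).prod ρ) :=
    Integrable.of_bound hm2.aestronglyMeasurable 1 (ae_of_all _ fun p => by
        rw [Real.norm_of_nonneg (candidate_nonneg hα γ _)]
        exact candidate_le_one hα1 hγ.le _)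
  rw [integral_map (by fun_prop) hm1.aestronglyMeasurable, integral_prod _ hint]
  have h1 : ((∫ z, Real.exp (γ * z) ∂ρ) * (lam / (lam + γ * c))) * candidate α γ x =
      ∫ w, α * Real.exp (-(γ * x)) * (∫ z, Real.exp (γ * z) ∂ρ) * Real.exp (-(γ * c * w))
        ∂(expMeasure lam) := by
    rw [integral_const_mul, integral_exp_neg_expMeasure hlam (by positivity), candidate,
      if_neg hx.not_gt]
    ring
  rw [h1]
  have hpos := ae_pos_expMeasure hlam
  refine integral_mono_ae ?_ hint.integral_prod_left ?_
  · refine Integrable.const_mul (Integrable.of_bound (by fun_prop) 1 ?_) _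
    filter_upwards [hpos] with w hw
    rw [Real.norm_of_nonneg (Real.exp_pos _).le, Real.exp_le_one_iff]
    have : 0 < γ * c * w := by positivity
    linarith
  · filter_upwards [hpos] with w hw
    have hy : 0 ≤ x + c * w := by positivity
    have h := mul_mgf_le_integral_candidate hα hα1 hγ.le hexp (htail _ hy)
    have h2 : α * Real.exp (-(γ * x)) * (∫ z, Real.exp (γ * z) ∂ρ) * Real.exp (-(γ * c * w)) =
        α * Real.exp (-(γ * (x + c * w))) * ∫ z, Real.exp (γ * z) ∂ρ := by
      have : Real.exp (-(γ * (x + c * w))) = Real.exp (-(γ * x)) * Real.exp (-(γ * c * w)) := by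
        rw [← Real.exp_add]; ring_nf
      rw [this]; ring
    simp only [← add_sub_assoc]
    exact h2.le.trans h

/-- An exponential lower bound for the ruin probability: the exponent `γ` lies strictly above the
adjustment coefficient, and `1 / α` bounds the exponential moments of the excesses. -/
theorem candidate_lt_ruinProb [IsProbabilityMeasure P] {ρ : Measure ℝ} [IsProbabilityMeasure ρ]
    {α γ lam c : ℝ} {A : ℝ≥0 → Ω → ℕ} {Z : ℕ → Ω → ℝ} (h : IsClaimsProcess P lam ρ A Z)
    (hα : 0 < α) (hα1 : α ≤ 1) (hγ : 0 < γ) (hc : 0 < c)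
    (hmean : Integrable (fun z => z) ρ) (hload : lam * ∫ z, z ∂ρ < c)
    (hexp : Integrable (fun z => Real.exp (γ * z)) ρ)
    (hadj : γ * c < lam * ((∫ z, Real.exp (γ * z) ∂ρ) - 1))
    (htail : ∀ y, 0 ≤ y → α * ∫ z in Ioi y, Real.exp (γ * (z - y)) ∂ρ ≤ ρ.real (Ioi y))
    {x : ℝ} (hx : 0 ≤ x) :
    α * Real.exp (-(γ * x)) < ruinProb P c A Z x := by
  have hlam := h.poisson.rate_pos
  have := isProbabilityMeasure_expMeasure hlam
  obtain ⟨ξ, hξm, hξi, hξlaw, hruin⟩ := h.exists_walk c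
  have hm2 : Measurable fun p : ℝ × ℝ => c * p.1 - p.2 := by fun_prop
  have hwint : Integrable (fun w => w) (expMeasure lam) :=
    Integrable.of_integral_ne_zero (by rw [integral_id_expMeasure hlam]; positivity)
  have h1 : Integrable (fun p : ℝ × ℝ => c * p.1) ((expMeasure lam).prod ρ) :=
    (hwint.comp_fst ρ).const_mul c
  have h2 : Integrable (fun p : ℝ × ℝ => p.2) ((expMeasure lam).prod ρ) :=
    hmean.comp_snd (expMeasure lam)
  have hηint : Integrable (fun y => y) (((expMeasure lam).prod ρ).map fun p => c * p.1 - p.2) :=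
    (integrable_map_measure (by fun_prop) hm2.aemeasurable).2 (h1.sub h2)
  have hηmean : 0 < ∫ y, y ∂(((expMeasure lam).prod ρ).map fun p => c * p.1 - p.2) := by
    rw [integral_map hm2.aemeasurable (by fun_prop), integral_sub h1 h2, integral_const_mul,
      integral_fun_fst (fun w => w), integral_fun_snd (fun z => z), integral_id_expMeasure hlam]
    simp only [probReal_univ, one_smul, sub_pos, mul_one_div]
    rw [lt_div_iff₀ hlam]
    linarith
  have hq : 1 < (∫ z, Real.exp (γ * z) ∂ρ) * (lam / (lam + γ * c)) := by
    rw [← mul_div_assoc, one_lt_div (by positivity)]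
    linarith
  have hφ : ∀ y, 0 ≤ y → candidate α γ y = α * Real.exp (-(γ * y)) := fun y hy => by
    rw [candidate, if_neg hy.not_gt]
  have hstep : ∀ y, 0 ≤ y → candidate α γ y <
      ∫ e, candidate α γ (y + e) ∂(((expMeasure lam).prod ρ).map fun p => c * p.1 - p.2) := by
    intro y hy
    refine lt_of_lt_of_le ?_ (mul_candidate_le_integral_step hα.le hα1 hγ hlam hc hexp htail hy)
    have : 0 < candidate α γ y := by rw [hφ y hy]; positivity
    exact lt_mul_of_one_lt_left this hq
  rw [← hφ x hx]
  exact (hstep x hx).trans_le <| (integral_le_prob_walk_neg hξm hξi hξlaw hηint hηmean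
    (measurable_candidate α γ) (candidate_nonneg hα.le γ) (candidate_le_one hα1 hγ.le)
    (fun y hy => if_pos hy) (tendsto_candidate α hγ) (fun y hy => (hstep y hy).le) hx).trans
    (hruin x)

/-! ### Moments -/

lemma integrable_pow_of_mgf {ν : Measure ℝ}
    (hmgf : ∃ u₀ > 0, ∀ u : ℝ, |u| < u₀ → Integrable (fun y => Real.exp (u * y)) ν) (k : ℕ) :
    Integrable (fun y => y ^ k) ν := by
  obtain ⟨u₀, hu₀, h⟩ := hmgf
  refine integrable_pow_of_integrable_exp_mul (X := id) (t := u₀ / 2) (by positivity)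
    (h _ ?_) (h _ ?_) k
  · rw [abs_of_pos (by positivity)]; linarith
  · rw [abs_neg, abs_of_pos (by positivity)]; linarith

lemma integral_pow_pos {ν : Measure ℝ} [IsProbabilityMeasure ν] (hpos : ∀ᵐ y ∂ν, 0 < y) {k : ℕ}
    (hint : Integrable (fun y => y ^ k) ν) : 0 < ∫ y, y ^ k ∂ν := by
  rw [integral_pos_iff_support_of_nonneg_ae (hpos.mono fun y hy => (pow_pos hy k).le) hint]
  have : ∀ᵐ y ∂ν, y ∈ Function.support fun y : ℝ => y ^ k :=
    hpos.mono fun y hy => (pow_pos hy k).ne'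
  rw [measure_eq_measure_of_null_sdiff (subset_univ _)]
  · simp
  · rw [← compl_eq_univ_sdiff]; exact this

/-- The cubic term of the exponential series makes the inequality strict. -/
lemma lt_integral_exp {ν : Measure ℝ} [IsProbabilityMeasure ν] (hpos : ∀ᵐ y ∂ν, 0 < y)
    (hpow : ∀ k : ℕ, Integrable (fun y => y ^ k) ν) {a : ℝ} (ha : 0 < a)
    (hexp : Integrable (fun y => Real.exp (a * y)) ν) :
    1 + a * ∫ y, y ∂ν + a ^ 2 / 2 * ∫ y, y ^ 2 ∂ν < ∫ y, Real.exp (a * y) ∂ν := by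
  have h1 : Integrable (fun y => y) ν := by simpa using hpow 1
  have h3 := integral_pow_pos hpos (hpow 3)
  have i1 : Integrable (fun y => 1 + a * y) ν := (integrable_const 1).add (h1.const_mul a)
  have i2 : Integrable (fun y => 1 + a * y + a ^ 2 / 2 * y ^ 2) ν :=
    i1.add ((hpow 2).const_mul _)
  have i3 : Integrable (fun y => 1 + a * y + a ^ 2 / 2 * y ^ 2 + a ^ 3 / 6 * y ^ 3) ν :=
    i2.add ((hpow 3).const_mul _)
  have hle : ∫ y, (1 + a * y + a ^ 2 / 2 * y ^ 2 + a ^ 3 / 6 * y ^ 3) ∂ν ≤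
      ∫ y, Real.exp (a * y) ∂ν := by
    refine integral_mono_ae i3 hexp (hpos.mono fun y hy => ?_)
    have := Real.sum_le_exp_of_nonneg (x := a * y) (by positivity) 4
    simp only [Finset.sum_range_succ, Finset.sum_range_zero, Nat.factorial] at this
    norm_num at this
    refine le_trans (le_of_eq ?_) this
    ring
  rw [integral_add i2 ((hpow 3).const_mul _), integral_add i1 ((hpow 2).const_mul _),
    integral_add (integrable_const 1) (h1.const_mul a), integral_const, probReal_univ, one_smul,
    integral_const_mul, integral_const_mul, integral_const_mul] at hle
  have : 0 < a ^ 3 / 6 * ∫ y, y ^ 3 ∂ν := by positivity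
  linarith

/-! ### The distribution of the excess over a threshold -/

lemma lintegral_cond (ν : Measure ℝ) (s : Set ℝ) (f : ℝ → ℝ≥0∞) :
    ∫⁻ y, f y ∂(ProbabilityTheory.cond ν s) = (ν s)⁻¹ * ∫⁻ y in s, f y ∂ν := by
  rw [ProbabilityTheory.cond, lintegral_smul_measure, smul_eq_mul]

lemma integrable_cond {ν : Measure ℝ} {s : Set ℝ} (hs : ν s ≠ 0) {f : ℝ → ℝ}
    (hf : Integrable f ν) : Integrable f (ProbabilityTheory.cond ν s) :=
  hf.restrict.smul_measure (ENNReal.inv_ne_top.2 hs)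

lemma expExcess_mono {ν : Measure ℝ} {a b : ℝ} (hab : a ≤ b) (d : ℝ) :
    expExcess ν a d ≤ expExcess ν b d := by
  refine lintegral_mono_ae ?_
  filter_upwards [ae_cond_mem (μ := ν) (measurableSet_Ioi (a := d))] with y hy
  have : 0 ≤ y - d := sub_nonneg.2 (mem_Ioi.1 hy).le
  gcongr

/-- The mean excess is controlled by the second moment, as `z ≤ 1 + z²`. -/
lemma meanExcess_le {ν : Measure ℝ} [IsProbabilityMeasure ν]
    (h1 : Integrable (fun y => y) ν) (h2 : Integrable (fun y => y ^ 2) ν) {a d : ℝ} (ha : 0 ≤ a)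
    (hd : d ∈ thresholds ν) (hfin : expExcess ν a d ≠ ∞) :
    meanExcess ν d ≤ 1 + (expExcess ν a d).toReal := by
  have hd' := hd.2.ne'
  have := cond_isProbabilityMeasure hd'
  have hi1 : Integrable (fun y => y - d) (ProbabilityTheory.cond ν (Ioi d)) :=
    integrable_cond hd' (h1.sub (integrable_const d))
  have hi2 : Integrable (fun y => (y - d) ^ 2) (ProbabilityTheory.cond ν (Ioi d)) := by
    refine integrable_cond hd' (((h2.sub (h1.const_mul (2 * d))).add
      (integrable_const (d ^ 2))).congr (ae_of_all _ fun y => ?_))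
    simp only [Pi.add_apply, Pi.sub_apply]
    ring
  calc meanExcess ν d
      ≤ ∫ y, (1 + (y - d) ^ 2) ∂(ProbabilityTheory.cond ν (Ioi d)) :=
        integral_mono hi1 ((integrable_const 1).add hi2) fun y => by
          change y - d ≤ 1 + (y - d) ^ 2
          nlinarith [sq_nonneg (y - d - 1)]
    _ = 1 + (∫⁻ y, ENNReal.ofReal ((y - d) ^ 2) ∂(ProbabilityTheory.cond ν (Ioi d))).toReal := by
        rw [integral_add (integrable_const 1) hi2, integral_const, probReal_univ, one_smul,
          integral_eq_lintegral_of_nonneg_ae (ae_of_all _ fun y => sq_nonneg _)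
            hi2.aestronglyMeasurable]
    _ ≤ 1 + (expExcess ν a d).toReal := by
        gcongr
        refine lintegral_mono_ae ?_
        filter_upwards [ae_cond_mem (μ := ν) (measurableSet_Ioi (a := d))] with y hy
        have : 0 ≤ y - d := sub_nonneg.2 (mem_Ioi.1 hy).le
        exact ENNReal.ofReal_le_ofReal (le_mul_of_one_le_right (sq_nonneg _)
          (Real.one_le_exp (mul_nonneg ha this)))

lemma bddAbove_meanExcess {ν : Measure ℝ} [IsProbabilityMeasure ν]
    (h1 : Integrable (fun y => y) ν) (h2 : Integrable (fun y => y ^ 2) ν) {γ a ε : ℝ}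
    (hγ : 0 ≤ γ) (ha : 0 ≤ a) (hfin : ⨆ d ∈ thresholds ν, expExcess ν a d < ∞) :
    BddAbove ((fun d => γ * meanExcess ν d + ε) '' thresholds ν) := by
  refine ⟨γ * (1 + (⨆ d ∈ thresholds ν, expExcess ν a d).toReal) + ε, ?_⟩
  rintro _ ⟨d, hd, rfl⟩
  have hle : expExcess ν a d ≤ ⨆ d ∈ thresholds ν, expExcess ν a d :=
    le_iSup₂ (f := fun d _ => expExcess ν a d) d hd
  have := meanExcess_le h1 h2 ha hd (hle.trans_lt hfin).ne
  have := ENNReal.toReal_mono hfin.ne hle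
  change γ * meanExcess ν d + ε ≤ _
  gcongr
  linarith

lemma exists_isAdmissible {ν : Measure ℝ} {θ ε m : ℝ} (hγ : 0 ≤ gam ν θ) (hm : 0 < m)
    (hε : 0 < ε) (hfin : ⨆ d ∈ thresholds ν, expExcess ν (gam ν θ / √m) d < ∞) :
    ∃ N, IsAdmissible ν θ ε m N := by
  set γ := gam ν θ with hγdef
  set C := ⨆ d ∈ thresholds ν, expExcess ν (γ / √m) d with hC
  set N := max (delta ν θ ε ^ 2) m + 1 + (γ ^ 2 * C.toReal / ε) ^ 2 with hN
  have hbig : max (delta ν θ ε ^ 2) m < N := by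
    have := sq_nonneg (γ ^ 2 * C.toReal / ε)
    linarith
  have hmN : m < N := (le_max_right _ _).trans_lt hbig
  have hsm : 0 < √m := Real.sqrt_pos.2 hm
  have hsN : 0 < √N := Real.sqrt_pos.2 (hm.trans hmN)
  have hmN' : √m ≤ √N := Real.sqrt_le_sqrt hmN.le
  have hsqrt : γ ^ 2 * C.toReal / ε ≤ √N := by
    refine Real.le_sqrt_of_sq_le ?_
    have : (0 : ℝ) ≤ max (delta ν θ ε ^ 2) m := (sq_nonneg _).trans (le_max_left _ _)
    linarith
  refine ⟨N, hbig, iSup₂_le fun d hd => ?_⟩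
  -- On `[0, 1]` both the weight `1 - w` and the ratio `γ w / √N` to `γ / √m` are at most one.
  have hint : ∫⁻ w in Icc (0 : ℝ) 1, ENNReal.ofReal (1 - w) * expExcess ν (γ * w / √N) d ≤ C := by
    calc _ ≤ ∫⁻ _ in Icc (0 : ℝ) 1, C := by
          refine setLIntegral_mono' measurableSet_Icc fun w hw => ?_
          have h1 : ENNReal.ofReal (1 - w) ≤ 1 :=
            ENNReal.ofReal_le_one.2 (by linarith [hw.1])
          have h2 : γ * w / √N ≤ γ / √m := by
            have := mul_le_of_le_one_right hγ hw.2
            gcongr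
          have h3 : expExcess ν (γ / √m) d ≤ C :=
            le_iSup₂ (f := fun d _ => expExcess ν (γ / √m) d) d hd
          exact (mul_le_mul' h1 ((expExcess_mono h2 d).trans h3)).trans (one_mul C).le
      _ = C := by simp
  calc _ ≤ ENNReal.ofReal (γ ^ 2 / √N) * C := by gcongr
    _ = ENNReal.ofReal (γ ^ 2 / √N * C.toReal) := by
        rw [ENNReal.ofReal_mul (by positivity), ENNReal.ofReal_toReal hfin.ne]
    _ ≤ ENNReal.ofReal ε := by
        refine ENNReal.ofReal_le_ofReal ?_
        rw [div_le_iff₀ hε] at hsqrt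
        rw [div_mul_eq_mul_div, div_le_iff₀ hsN]
        linarith

/-! ### Exponential moments of the excess -/

/-- Taylor's formula for the exponential with integral remainder of second order. -/
lemma ofReal_exp_eq_taylor {b : ℝ} (hb : 0 ≤ b) :
    ENNReal.ofReal (Real.exp b) = ENNReal.ofReal (1 + b) + ENNReal.ofReal (b ^ 2) *
      ∫⁻ w in Icc (0 : ℝ) 1, ENNReal.ofReal (1 - w) * ENNReal.ofReal (Real.exp (w * b)) := by
  have hcont : Continuous fun w : ℝ => b ^ 2 * ((1 - w) * Real.exp (w * b)) := by fun_prop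
  have hFTC : ∫ w in (0 : ℝ)..1, b ^ 2 * ((1 - w) * Real.exp (w * b)) = Real.exp b - (1 + b) := by
    have hder : ∀ w ∈ uIcc (0 : ℝ) 1, HasDerivAt
        (fun w => b * (1 - w) * Real.exp (w * b) + Real.exp (w * b))
        (b ^ 2 * ((1 - w) * Real.exp (w * b))) w := fun w _ => by
      have he : HasDerivAt (fun w => Real.exp (w * b)) (Real.exp (w * b) * (1 * b)) w :=
        ((hasDerivAt_id w).mul_const b).exp
      have hl : HasDerivAt (fun w => b * (1 - w)) (b * (-1)) w :=
        ((hasDerivAt_id w).const_sub 1).const_mul b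
      exact ((hl.mul he).add he).congr_deriv (by ring)
    rw [intervalIntegral.integral_eq_sub_of_hasDerivAt hder (hcont.intervalIntegrable _ _)]
    simp
    ring
  have hnn : ∀ᵐ w ∂(volume.restrict (Icc (0 : ℝ) 1)),
      0 ≤ b ^ 2 * ((1 - w) * Real.exp (w * b)) := by
    filter_upwards [ae_restrict_mem measurableSet_Icc] with w hw
    have : 0 ≤ 1 - w := sub_nonneg.2 hw.2
    positivity
  have hrem : ENNReal.ofReal (b ^ 2) *
      ∫⁻ w in Icc (0 : ℝ) 1, ENNReal.ofReal (1 - w) * ENNReal.ofReal (Real.exp (w * b)) =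
      ENNReal.ofReal (Real.exp b - (1 + b)) := by
    rw [← hFTC, intervalIntegral.integral_of_le zero_le_one, ← integral_Icc_eq_integral_Ioc,
      ofReal_integral_eq_lintegral_ofReal hcont.continuousOn.integrableOn_Icc hnn,
      ← lintegral_const_mul' _ _ ENNReal.ofReal_ne_top]
    refine setLIntegral_congr_fun measurableSet_Icc fun w hw => ?_
    rw [ENNReal.ofReal_mul (sq_nonneg b), ENNReal.ofReal_mul (sub_nonneg.2 hw.2)]
  rw [hrem, ← ENNReal.ofReal_add (by positivity) (by linarith [Real.add_one_le_exp b])]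
  ring_nf

/-- The exponential moment of the excess over `d`, bounded through its mean and the remainder
term of Taylor's formula. -/
lemma lintegral_exp_excess_le {ν : Measure ℝ} [IsProbabilityMeasure ν]
    (h1 : Integrable (fun y => y) ν) {γ N n e d : ℝ} (hγ : 0 ≤ γ) (hN : 0 < N) (hn : N ≤ n)
    (he : 0 ≤ e) (hd : d ∈ thresholds ν)
    (hrem : ENNReal.ofReal (γ ^ 2 / √N) *
      ∫⁻ w in Icc (0 : ℝ) 1, ENNReal.ofReal (1 - w) * expExcess ν (γ * w / √N) d
        ≤ ENNReal.ofReal e) :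
    ∫⁻ y, ENNReal.ofReal (Real.exp (γ / √n * (y - d))) ∂(ProbabilityTheory.cond ν (Ioi d)) ≤
      ENNReal.ofReal (1 + (γ * meanExcess ν d + e) / √n) := by
  have hd' := hd.2.ne'
  have := cond_isProbabilityMeasure hd'
  set κ := ProbabilityTheory.cond ν (Ioi d) with hκ
  have hκd : ∀ᵐ y ∂κ, 0 ≤ y - d := by
    filter_upwards [ae_cond_mem (μ := ν) (measurableSet_Ioi (a := d))] with y hy
    exact sub_nonneg.2 (mem_Ioi.1 hy).le
  have hsN : 0 < √N := Real.sqrt_pos.2 hN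
  have hsn : 0 < √n := Real.sqrt_pos.2 (hN.trans_le hn)
  have hle : √N ≤ √n := Real.sqrt_le_sqrt hn
  have hi1 : Integrable (fun y => γ / √n * (y - d)) κ :=
    (integrable_cond hd' (h1.sub (integrable_const d))).const_mul _
  -- The part of the remainder term that depends on the level `w`.
  let r : ℝ → ℝ → ℝ≥0∞ := fun y w =>
    ENNReal.ofReal (1 - w) * ENNReal.ofReal ((y - d) ^ 2 * Real.exp (γ * w / √N * (y - d)))
  have hrm : Measurable (Function.uncurry r) := by
    have hr1 : Measurable fun p : ℝ × ℝ => ENNReal.ofReal (1 - p.2) :=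
      Measurable.ennreal_ofReal (by fun_prop)
    have hr2 : Measurable fun p : ℝ × ℝ =>
        ENNReal.ofReal ((p.1 - d) ^ 2 * Real.exp (γ * p.2 / √N * (p.1 - d))) :=
      Measurable.ennreal_ofReal (by fun_prop)
    exact hr1.mul hr2
  have hpt : ∀ᵐ y ∂κ, ENNReal.ofReal (Real.exp (γ / √n * (y - d))) ≤
      ENNReal.ofReal (1 + γ / √n * (y - d)) +
        ENNReal.ofReal (1 / √n) * (ENNReal.ofReal (γ ^ 2 / √N) * ∫⁻ w in Icc (0 : ℝ) 1, r y w) := by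
    filter_upwards [hκd] with y hy
    rw [ofReal_exp_eq_taylor (by positivity)]
    refine add_le_add le_rfl ?_
    rw [← lintegral_const_mul' _ _ ENNReal.ofReal_ne_top,
      ← lintegral_const_mul' _ _ ENNReal.ofReal_ne_top,
      ← lintegral_const_mul' _ _ ENNReal.ofReal_ne_top]
    refine setLIntegral_mono' measurableSet_Icc fun w hw => ?_
    have hw0 : 0 ≤ 1 - w := sub_nonneg.2 hw.2
    have hw1 := hw.1
    simp only [r]
    rw [← ENNReal.ofReal_mul hw0, ← ENNReal.ofReal_mul hw0, ← ENNReal.ofReal_mul (by positivity),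
      ← ENNReal.ofReal_mul (by positivity), ← ENNReal.ofReal_mul (by positivity)]
    refine ENNReal.ofReal_le_ofReal ?_
    have e1 : (γ / √n * (y - d)) ^ 2 * ((1 - w) * Real.exp (w * (γ / √n * (y - d)))) =
        1 / √n * (γ ^ 2 / √n * ((1 - w) * ((y - d) ^ 2 * Real.exp (γ * w / √n * (y - d))))) := by
      have : w * (γ / √n * (y - d)) = γ * w / √n * (y - d) := by ring
      rw [this]; ring
    rw [e1]
    gcongr
  have hmean : ∫⁻ y, ENNReal.ofReal (1 + γ / √n * (y - d)) ∂κ =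
      ENNReal.ofReal (1 + γ / √n * meanExcess ν d) := by
    have hi : Integrable (fun y => 1 + γ / √n * (y - d)) κ := (integrable_const 1).add hi1
    rw [← ofReal_integral_eq_lintegral_ofReal hi (hκd.mono fun y hy => by
        simp only [Pi.zero_apply]; positivity),
      integral_add (integrable_const 1) hi1, integral_const, probReal_univ, one_smul,
      integral_const_mul, meanExcess]
  calc ∫⁻ y, ENNReal.ofReal (Real.exp (γ / √n * (y - d))) ∂κ
      ≤ ∫⁻ y, (ENNReal.ofReal (1 + γ / √n * (y - d)) + ENNReal.ofReal (1 / √n) *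
          (ENNReal.ofReal (γ ^ 2 / √N) * ∫⁻ w in Icc (0 : ℝ) 1, r y w)) ∂κ := lintegral_mono_ae hpt
    _ = ENNReal.ofReal (1 + γ / √n * meanExcess ν d) + ENNReal.ofReal (1 / √n) *
          (ENNReal.ofReal (γ ^ 2 / √N) * ∫⁻ y, (∫⁻ w in Icc (0 : ℝ) 1, r y w) ∂κ) := by
        rw [lintegral_add_left (Measurable.ennreal_ofReal (by fun_prop)),
          lintegral_const_mul' _ _ ENNReal.ofReal_ne_top,
          lintegral_const_mul' _ _ ENNReal.ofReal_ne_top, hmean]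
    _ ≤ ENNReal.ofReal (1 + γ / √n * meanExcess ν d) +
          ENNReal.ofReal (1 / √n) * ENNReal.ofReal e := by
        gcongr
        refine le_trans (le_of_eq ?_) hrem
        rw [lintegral_lintegral_swap hrm.aemeasurable]
        congr 1
        refine lintegral_congr fun w => ?_
        rw [expExcess, ← lintegral_const_mul' _ _ ENNReal.ofReal_ne_top]
    _ = ENNReal.ofReal (1 + (γ * meanExcess ν d + e) / √n) := by
        have hme : 0 ≤ meanExcess ν d := integral_nonneg_of_ae hκd
        rw [← ENNReal.ofReal_mul (by positivity), ← ENNReal.ofReal_add (by positivity)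
          (by positivity)]
        congr 1
        ring

/-- A bound on the conditional exponential moment, restated without the conditioning. It holds
trivially at thresholds that `Y` does not exceed. -/
lemma setLIntegral_exp_excess_le {ν : Measure ℝ} [IsProbabilityMeasure ν] {a K : ℝ}
    (h : ∀ d ∈ thresholds ν, ∫⁻ y, ENNReal.ofReal (Real.exp (a * (y - d)))
      ∂(ProbabilityTheory.cond ν (Ioi d)) ≤ ENNReal.ofReal K) {d : ℝ} (hd : 0 ≤ d) :
    ∫⁻ y in Ioi d, ENNReal.ofReal (Real.exp (a * (y - d))) ∂ν ≤
      ν (Ioi d) * ENNReal.ofReal K := by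
  rcases eq_or_ne (ν (Ioi d)) 0 with h0 | h0
  · rw [Measure.restrict_eq_zero.2 h0]; simp
  · have := h d ⟨hd, pos_iff_ne_zero.2 h0⟩
    rw [lintegral_cond, ← ENNReal.div_eq_inv_mul, ENNReal.div_le_iff_le_mul (Or.inl h0)
      (Or.inl (measure_ne_top _ _)), mul_comm] at this
    exact this

lemma integrable_exp_of_setLIntegral_le {ν : Measure ℝ} [IsProbabilityMeasure ν]
    (hpos : ∀ᵐ y ∂ν, 0 < y) {a K : ℝ}
    (h : ∀ d, 0 ≤ d → ∫⁻ y in Ioi d, ENNReal.ofReal (Real.exp (a * (y - d))) ∂ν ≤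
      ν (Ioi d) * ENNReal.ofReal K) : Integrable (fun y => Real.exp (a * y)) ν := by
  have h0 := h 0 le_rfl
  rw [Measure.restrict_eq_self_of_ae_mem (s := Ioi (0 : ℝ)) hpos] at h0
  simp only [sub_zero] at h0
  refine (lintegral_ofReal_ne_top_iff_integrable (by fun_prop)
    (ae_of_all _ fun y => (Real.exp_pos _).le)).1 (h0.trans_lt ?_).ne
  exact ENNReal.mul_lt_top (measure_lt_top _ _) ENNReal.ofReal_lt_top

lemma setIntegral_exp_excess_le {ν : Measure ℝ} [IsProbabilityMeasure ν] {a K d : ℝ} (hK : 0 ≤ K)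
    (h : ∫⁻ y in Ioi d, ENNReal.ofReal (Real.exp (a * (y - d))) ∂ν ≤
      ν (Ioi d) * ENNReal.ofReal K) :
    ∫ y in Ioi d, Real.exp (a * (y - d)) ∂ν ≤ ν.real (Ioi d) * K := by
  rw [integral_eq_lintegral_of_nonneg_ae (ae_of_all _ fun y => (Real.exp_pos _).le)
    (by fun_prop)]
  refine (ENNReal.toReal_mono (ENNReal.mul_ne_top (measure_ne_top _ _)
    ENNReal.ofReal_ne_top) h).trans (le_of_eq ?_)
  rw [ENNReal.toReal_mul, ENNReal.toReal_ofReal hK, measureReal_def]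

/-! ### The scaled model -/

lemma gam_pos {ν : Measure ℝ} {θ : ℝ} (hθ : 0 < θ) (h1 : 0 < ∫ y, y ∂ν)
    (h2 : 0 < ∫ y, y ^ 2 ∂ν) : 0 < gam ν θ := by
  unfold gam; positivity

lemma setIntegral_exp_scaledLaw (ν : Measure ℝ) {n : ℝ} (hn : 0 < n) (γ x : ℝ) :
    ∫ z in Ioi x, Real.exp (γ * (z - x)) ∂(scaledLaw ν n) =
      ∫ y in Ioi (x * √n), Real.exp (γ / √n * (y - x * √n)) ∂ν := by
  have hs : 0 < √n := Real.sqrt_pos.2 hn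
  have hpre : (fun y => y / √n) ⁻¹' Ioi x = Ioi (x * √n) := by
    ext y; simp [lt_div_iff₀ hs]
  rw [scaledLaw, setIntegral_map measurableSet_Ioi (by fun_prop) (by fun_prop), hpre]
  congr 1
  funext y
  congr 1
  field_simp

lemma scaledLaw_real_Ioi (ν : Measure ℝ) {n : ℝ} (hn : 0 < n) (x : ℝ) :
    (scaledLaw ν n).real (Ioi x) = ν.real (Ioi (x * √n)) := by
  have hs : 0 < √n := Real.sqrt_pos.2 hn
  have hpre : (fun y => y / √n) ⁻¹' Ioi x = Ioi (x * √n) := by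
    ext y; simp [lt_div_iff₀ hs]
  rw [scaledLaw, map_measureReal_apply (by fun_prop) measurableSet_Ioi, hpre]

end Ruin

theorem mainTheorem3
    (ν : Measure ℝ) [IsProbabilityMeasure ν] (hpos : ∀ᵐ y ∂ν, 0 < y)
    (hmgf : ∃ u₀ > 0, ∀ u : ℝ, |u| < u₀ → Integrable (fun y => Real.exp (u * y)) ν)
    (lam θ c : ℝ) (hlam : 0 < lam) (hθ : 0 < θ) (hc : c = (1 + θ) * (lam * ∫ y, y ∂ν))
    (m : ℝ) (hm : 0 < m)
    (hZ : ⨆ d ∈ Ruin.thresholds ν, Ruin.expExcess ν (Ruin.gam ν θ / √m) d < ∞)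
    (ε : ℝ) (hε : 0 < ε) :
    BddAbove ((fun d => Ruin.gam ν θ * Ruin.meanExcess ν d + ε) '' Ruin.thresholds ν) ∧
    (∃ N : ℝ, Ruin.IsAdmissible ν θ ε m N) ∧
    ∀ N : ℝ, Ruin.IsAdmissible ν θ ε m N → ∀ n : ℝ, N < n →
      ∀ (Ω : Type*) [MeasurableSpace Ω] (P : Measure Ω) [IsProbabilityMeasure P]
        (A : ℝ≥0 → Ω → ℕ) (Z : ℕ → Ω → ℝ),
        Ruin.IsClaimsProcess P (n * lam) (Ruin.scaledLaw ν n) A Z →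
        ∀ x : ℝ, 0 ≤ x →
          (1 - Ruin.delta ν θ ε / √n) * Real.exp (-(Ruin.gam ν θ * x)) <
            Ruin.ruinProb P (Ruin.scaledPremium ν lam c n) A Z x := by
  have hpow : ∀ k : ℕ, Integrable (fun y => y ^ k) ν := Ruin.integrable_pow_of_mgf hmgf
  have h1 : Integrable (fun y => y) ν := by simpa using hpow 1
  have hμ : 0 < ∫ y, y ∂ν := by simpa using Ruin.integral_pow_pos hpos (hpow 1)
  have hμ2 : 0 < ∫ y, y ^ 2 ∂ν := Ruin.integral_pow_pos hpos (hpow 2)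
  have hγ : 0 < Ruin.gam ν θ := Ruin.gam_pos hθ hμ hμ2
  have hbdd := Ruin.bddAbove_meanExcess (ε := ε) h1 (hpow 2) hγ.le
    (div_nonneg hγ.le (Real.sqrt_nonneg m)) hZ
  refine ⟨hbdd, Ruin.exists_isAdmissible hγ.le hm hε hZ, ?_⟩
  intro N hN n hNn Ω _ P _ A Z hAZ x hx
  set δ := Ruin.delta ν θ ε with hδdef
  have hγ2 : Ruin.gam ν θ * ∫ y, y ^ 2 ∂ν = 2 * θ * ∫ y, y ∂ν := div_mul_cancel₀ _ hμ2.ne'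
  set γ := Ruin.gam ν θ with hγdef
  have hN0 : 0 < N := hm.trans ((le_max_right _ _).trans_lt hN.1)
  have hn0 : 0 < n := hN0.trans hNn
  have hδ : 0 < δ := hθ.trans_le (le_max_left _ _)
  have hs : 0 < √n := Real.sqrt_pos.2 hn0
  have hss : √n * √n = n := Real.mul_self_sqrt hn0.le
  have hδn : δ < √n := Real.lt_sqrt_of_sq_lt (((le_max_left _ _).trans_lt hN.1).trans hNn)
  have hα : 0 < 1 - δ / √n := sub_pos.2 ((div_lt_one hs).2 hδn)
  have hα1 : 1 - δ / √n ≤ 1 := sub_le_self _ (by positivity)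
  have hexc : ∀ d ∈ Ruin.thresholds ν, ∫⁻ y, ENNReal.ofReal (Real.exp (γ / √n * (y - d)))
      ∂(ProbabilityTheory.cond ν (Ioi d)) ≤ ENNReal.ofReal (1 + δ / √n) := by
    intro d hd
    have hrem := (le_iSup₂ (f := fun d (_ : d ∈ Ruin.thresholds ν) =>
      ENNReal.ofReal (γ ^ 2 / √N) * ∫⁻ w in Icc (0 : ℝ) 1,
        ENNReal.ofReal (1 - w) * Ruin.expExcess ν (γ * w / √N) d) d hd).trans hN.2
    refine (Ruin.lintegral_exp_excess_le h1 hγ.le hN0 hNn.le hε.le hd hrem).trans ?_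
    have : γ * Ruin.meanExcess ν d + ε ≤ δ :=
      (le_csSup hbdd (mem_image_of_mem _ hd)).trans (le_max_right _ _)
    gcongr
  have htail := fun d (hd : 0 ≤ d) => Ruin.setLIntegral_exp_excess_le hexc hd
  have hexp := Ruin.integrable_exp_of_setLIntegral_le hpos htail
  have hscale : Measurable fun y : ℝ => y / √n := by fun_prop
  have hprob : IsProbabilityMeasure (Ruin.scaledLaw ν n) :=
    Measure.isProbabilityMeasure_map hscale.aemeasurable
  have hmeanZ : ∫ z, z ∂(Ruin.scaledLaw ν n) = (∫ y, y ∂ν) / √n := by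
    rw [Ruin.scaledLaw, integral_map hscale.aemeasurable (by fun_prop), integral_div]
  have hmgfZ : ∫ z, Real.exp (γ * z) ∂(Ruin.scaledLaw ν n) = ∫ y, Real.exp (γ / √n * y) ∂ν := by
    rw [Ruin.scaledLaw, integral_map hscale.aemeasurable (by fun_prop)]
    simp_rw [div_mul_eq_mul_div, mul_div_assoc]
  have hprem : Ruin.scaledPremium ν lam c n = √n * (lam * ∫ y, y ∂ν) + θ * (lam * ∫ y, y ∂ν) := by
    rw [Ruin.scaledPremium, hc]; ring
  refine Ruin.candidate_lt_ruinProb hAZ hα hα1 hγ ?_ ?_ ?_ ?_ ?_ ?_ hx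
  · rw [hprem]; positivity
  · exact (integrable_map_measure (by fun_prop) hscale.aemeasurable).2 (h1.div_const _)
  · have : n * lam * ((∫ y, y ∂ν) / √n) = √n * (lam * ∫ y, y ∂ν) := by
      field_simp
      rw [sq, hss]
    rw [hmeanZ, hprem, this]
    have : 0 < θ * (lam * ∫ y, y ∂ν) := by positivity
    linarith
  · refine (integrable_map_measure (by fun_prop) hscale.aemeasurable).2 (hexp.congr ?_)
    exact ae_of_all _ fun y => by simp only [Function.comp]; congr 1; ring
  · rw [hmgfZ, hprem]
    have h := Ruin.lt_integral_exp hpos hpow (div_pos hγ hs) hexp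
    -- With these scalings the second-order expansion of the exponential moment is exactly `γ c_n`.
    have hid : γ * (√n * (lam * ∫ y, y ∂ν) + θ * (lam * ∫ y, y ∂ν)) = n * lam *
        (1 + γ / √n * ∫ y, y ∂ν + (γ / √n) ^ 2 / 2 * ∫ y, y ^ 2 ∂ν - 1) := by
      have e : (γ / √n) ^ 2 / 2 * ∫ y, y ^ 2 ∂ν = γ * θ * (∫ y, y ∂ν) / n := by
        rw [div_pow, sq (√n), hss, sq γ]
        field_simp
        linear_combination hγ2
      rw [add_assoc, add_sub_cancel_left, e]
      field_simp
      linear_combination hss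
    rw [hid]
    have hnl : 0 < n * lam := by positivity
    gcongr
  · intro y hy
    rw [Ruin.setIntegral_exp_scaledLaw ν hn0, Ruin.scaledLaw_real_Ioi ν hn0]
    have h := Ruin.setIntegral_exp_excess_le (by positivity) (htail (y * √n) (by positivity))
    calc _ ≤ (1 - δ / √n) * (ν.real (Ioi (y * √n)) * (1 + δ / √n)) := by gcongr
      _ = ν.real (Ioi (y * √n)) * (1 - (δ / √n) ^ 2) := by ring
      _ ≤ ν.real (Ioi (y * √n)) :=
        mul_le_of_le_one_right measureReal_nonneg (sub_le_self _ (sq_nonneg _))
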